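/- Let $d\in\mathbb{N}$, let $M\subseteq\mathbb{R}^d$ be a nonempty Borel set with $-M=M$, and let $\mu$ be a finite Borel measure on $M$ that is invariant under the reflection $x\mapsto -x$. Let $X,X_1,X_2,\ldots$ and $Y,Y_1,Y_2,\ldots$ be independent $M$-valued random vectors on a common probability space such that $X,X_1,X_2,\ldots$ are identically distributed with a density $f$ with respect to $\mu$ and characteristic function $\varphi(t)=\mathbb{E}[\exp(\mathrm{i}t^\top X)]$, and $Y,Y_1,Y_2,\ldots$ are identically distributed with a density $g$ with respect to $\mu$ and characteristic function $\psi(t)=\mathbb{E}[\exp(\mathrm{i}t^\top Y)]$. Put $\varphi_n(t)=\frac1n\sum_{j=1}^n\exp(\mathrm{i}t^\top X_j)$, $\psi_m(t)=\frac1m\sum_{j=1}^m\exp(\mathrm{i}t^\top Y_j)$, $$T_{n,m}=\frac{nm}{n+m}\int_M|\varphi_n(t)-\psi_m(t)|^2\,\mu(\mathrm{d}t),\qquad \Delta=\int_M|\varphi(t)-\psi(t)|^2\,\mu(\mathrm{d}t).$$ Let $\mathrm{CS}(\xi)=\cos\xi+\sin\xi$, $\varrho(t)=\mathbb{E}[\mathrm{CS}(t^\top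 X)]$, $b(t)=\mathbb{E}[\mathrm{CS}(t^\top Y)]$, $z(t)=\varrho(t)-b(t)$, $K_1(s,t)=\mathrm{Cov}(\mathrm{CS}(s^\top X),\mathrm{CS}(t^\top X))$, $K_2(s,t)=\mathrm{Cov}(\mathrm{CS}(s^\top Y),\mathrm{CS}(t^\top Y))$, and, for $\tau\in[0,1]$, $K^*(s,t)=\tau K_1(s,t)+(1-\tau)K_2(s,t)$. If $\Delta>0$, then, whenever $n,m\to\infty$ (along arbitrary sequences $n=n(s)\to\infty$, $m=m(s)\to\infty$ as $s\to\infty$) in such a way that $\frac{m}{m+n}\to\tau\in[0,1]$, $$\sqrt{\frac{mn}{m+n}}\left(\frac{T_{n,m}}{\frac{mn}{m+n}}-\Delta\right)\stackrel{\mathcal{D}}{\longrightarrow}\mathrm{N}(0,\sigma^2),\qquad \sigma^2=4\int_M\int_M K^*(s,t)\,z(s)\,z(t)\,\mu(\mathrm{d}s)\,\mu(\mathrm{d}t),$$ where $\mathrm{N}(0,0)$ denotes the point mass at $0$. -/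

import Mathlib

open MeasureTheory ProbabilityTheory Filter Topology
open scoped NNReal ENNReal

noncomputable section

namespace CFTwoSample

variable {d : ℕ} {Ω : Type*}

/-- The empirical characteristic function `t ↦ n⁻¹ ∑_{j ≤ n} exp(i tᵀ Z_j(ω))` of the first `n`
terms of a sequence `Z` of random vectors (indexed from `0`). -/
def empCF (Z : ℕ → Ω → EuclideanSpace ℝ (Fin d)) (n : ℕ) (ω : Ω)
    (t : EuclideanSpace ℝ (Fin d)) : ℂ :=
  (1 / (n : ℂ)) * ∑ j ∈ Finset.range n, Complex.exp (Complex.I * ((inner ℝ t (Z j ω) : ℝ) : ℂ))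

/-- The two-sample statistic
`T_{n,m} = nm/(n+m) * ∫_M |φ_n(t) - ψ_m(t)|² μ(dt)`. -/
def statT (M : Set (EuclideanSpace ℝ (Fin d))) (μ : Measure (EuclideanSpace ℝ (Fin d)))
    (X Y : ℕ → Ω → EuclideanSpace ℝ (Fin d)) (n m : ℕ) (ω : Ω) : ℝ :=
  ((n : ℝ) * m / ((n : ℝ) + m)) * ∫ t in M, ‖empCF X n ω t - empCF Y m ω t‖ ^ 2 ∂μ

/-- `CS(ξ) = cos ξ + sin ξ`. -/
def CS (ξ : ℝ) : ℝ := Real.cos ξ + Real.sin ξ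

variable [MeasurableSpace Ω]

/-- `Δ = ∫_M |φ(t) - ψ(t)|² μ(dt)`, with `φ`, `ψ` the characteristic functions of `X` and `Y`. -/
def deviation (M : Set (EuclideanSpace ℝ (Fin d))) (μ : Measure (EuclideanSpace ℝ (Fin d)))
    (P : Measure Ω) (X Y : Ω → EuclideanSpace ℝ (Fin d)) : ℝ :=
  ∫ t in M, ‖charFun (P.map X) t - charFun (P.map Y) t‖ ^ 2 ∂μ

/-- `E[CS(tᵀ Z)]`; this is `ϱ(t)` for `Z = X` and `b(t)` for `Z = Y`. -/
def meanCS (P : Measure Ω) (Z : Ω → EuclideanSpace ℝ (Fin d))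
    (t : EuclideanSpace ℝ (Fin d)) : ℝ :=
  ∫ ω, CS (inner ℝ t (Z ω)) ∂P

/-- `z(t) = ϱ(t) - b(t)`. -/
def zFun (P : Measure Ω) (X Y : Ω → EuclideanSpace ℝ (Fin d))
    (t : EuclideanSpace ℝ (Fin d)) : ℝ :=
  meanCS P X t - meanCS P Y t

/-- `Cov(CS(sᵀ Z), CS(tᵀ Z))`; this is `K₁(s,t)` for `Z = X` and `K₂(s,t)` for `Z = Y`. -/
def covCS (P : Measure Ω) (Z : Ω → EuclideanSpace ℝ (Fin d))
    (s t : EuclideanSpace ℝ (Fin d)) : ℝ :=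
  covariance (fun ω => CS (inner ℝ s (Z ω))) (fun ω => CS (inner ℝ t (Z ω))) P

/-- `K*(s,t) = τ K₁(s,t) + (1 - τ) K₂(s,t)`. -/
def Kstar (P : Measure Ω) (X Y : Ω → EuclideanSpace ℝ (Fin d)) (τ : ℝ)
    (s t : EuclideanSpace ℝ (Fin d)) : ℝ :=
  τ * covCS P X s t + (1 - τ) * covCS P Y s t

/-- `σ² = 4 ∫_M ∫_M K*(s,t) z(s) z(t) μ(ds) μ(dt)`. -/
def sigmaSq (M : Set (EuclideanSpace ℝ (Fin d))) (μ : Measure (EuclideanSpace ℝ (Fin d)))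
    (P : Measure Ω) (X Y : Ω → EuclideanSpace ℝ (Fin d)) (τ : ℝ) : ℝ :=
  4 * ∫ t in M, ∫ s in M, Kstar P X Y τ s t * zFun P X Y s * zFun P X Y t ∂μ ∂μ

end CFTwoSample

end

/-! The statistic is a squared `L²(μ)` distance, and at a nonzero limit such a functional is
asymptotically linear. Since `μ` is reflection-invariant and `φ_n - ψ_m` is Hermitian, the product
of its real and imaginary parts is odd and integrates to zero. Hence `|·|²` may be replaced by `(Re
+ Im)²`, which turns `exp(iξ)` into the real function `CS ξ` (`statT_eq`, `deviation_eq`).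

With `A` the difference of the empirical means of `CS`, the identity `A² - z² = 2z(A - z) + (A -
z)²` splits the centred statistic into two parts (`integral_sq_sub_integral_sq`). The linear part is
a difference of centred averages of the bounded i.i.d. scalars `proj μ z (X_j)` and `proj μ z
(Y_j)`; the one-dimensional central limit theorem and independence of the samples give a Gaussian
limit (`tendstoInDistribution_two_sample`). By Fubini its variance is the double integral of the
covariance kernel (`variance_proj`, `sigmaSq_eq`).

The quadratic part has mean of order `1/n + 1/m`, so after scaling by `√(mn/(m+n)) = (1/n +
1/m)^(-1/2)` it vanishes in `L¹` (`tendstoInMeasure_remainder`). Slutsky's theorem concludes. No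
lower bound on the variance is needed, because `gaussianReal 0 0` is the Dirac mass at `0`. -/

namespace CFTwoSample

/-! ### Central limit theorem for two independent samples. -/

section TwoSampleCLT

variable {Ω : Type*} [MeasurableSpace Ω] {P : Measure Ω} [IsProbabilityMeasure P]

/-- A central limit theorem for the weighted difference of two independent normalized sums. -/
theorem tendstoInDistribution_two_sample {U V : ℕ → Ω → ℝ}
    (hindep : iIndepFun (Sum.elim U V) P)
    (hUm : ∀ j, Measurable (U j)) (hVm : ∀ j, Measurable (V j))
    (hU : ∀ j, IdentDistrib (U j) (U 0) P P) (hV : ∀ j, IdentDistrib (V j) (V 0) P P)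
    (hU2 : MemLp (U 0) 2 P) (hV2 : MemLp (V 0) 2 P)
    {n m : ℕ → ℕ} (hn : Tendsto n atTop atTop) (hm : Tendsto m atTop atTop)
    {a b : ℕ → ℝ} {α β : ℝ} (ha : Tendsto a atTop (𝓝 α)) (hb : Tendsto b atTop (𝓝 β))
    {v : ℝ≥0} (hv : (v : ℝ) = α ^ 2 * Var[U 0; P] + β ^ 2 * Var[V 0; P]) :
    TendstoInDistribution (fun s ω =>
        a s * ((√(n s))⁻¹ * (∑ k ∈ Finset.range (n s), U k ω - n s * P[U 0])) +
        b s * ((√(m s))⁻¹ * (∑ k ∈ Finset.range (m s), V k ω - m s * P[V 0])))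
      atTop (id : ℝ → ℝ) (fun _ => P) (gaussianReal 0 v) := by
  -- One sample: the classical theorem is reindexed along `k s → ∞`, and the deterministic weight `c
  -- s` is absorbed by Slutsky as a sequence converging in measure to a constant.
  have key : ∀ {W : ℕ → Ω → ℝ} (_ : iIndepFun W P) (_ : ∀ j, Measurable (W j))
      (_ : ∀ j, IdentDistrib (W j) (W 0) P P) (_ : MemLp (W 0) 2 P) {k : ℕ → ℕ}
      (_ : Tendsto k atTop atTop) {c : ℕ → ℝ} {γ : ℝ} (_ : Tendsto c atTop (𝓝 γ)) (t : ℝ),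
      Tendsto (fun s => charFun (P.map (fun ω => c s * ((√(k s))⁻¹ *
        (∑ i ∈ Finset.range (k s), W i ω - k s * P[W 0])))) t) atTop
        (𝓝 (charFun (gaussianReal 0 Var[W 0; P].toNNReal) (γ * t))) := by
    intro W hW hWm hWd hW2 k hk c γ hc t
    have h1 := tendstoInDistribution_inv_sqrt_mul_sum_sub
      (Y := (id : ℝ → ℝ)) (P' := gaussianReal 0 Var[W 0; P].toNNReal) HasLaw.id hW2 hW hWd
    have h2 : TendstoInDistribution (fun s ω => (√(k s))⁻¹ *
        (∑ i ∈ Finset.range (k s), W i ω - k s * P[W 0])) atTop (id : ℝ → ℝ) (fun _ => P)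
        (gaussianReal 0 Var[W 0; P].toNNReal) :=
      ⟨fun i => h1.forall_aemeasurable (k i), h1.aemeasurable_limit, h1.tendsto.comp hk⟩
    have h3 : TendstoInMeasure P (fun s (_ : Ω) => c s) atTop (fun _ => γ) :=
      tendstoInMeasure_of_tendsto_ae (fun _ => aestronglyMeasurable_const) (ae_of_all _ fun _ => hc)
    have h4 := h2.continuous_comp_prodMk_of_tendstoInMeasure_const
      (g := fun p : ℝ × ℝ => p.2 * p.1) (by fun_prop) h3 (fun _ => aemeasurable_const)
    have h5 := ProbabilityMeasure.tendsto_iff_tendsto_charFun.1 h4.tendsto t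
    simp only [ProbabilityMeasure.coe_mk, id] at h5
    rwa [charFun_map_mul] at h5
  have hUi : iIndepFun U P := hindep.precomp (g := Sum.inl) Sum.inl_injective
  have hVi : iIndepFun V P := hindep.precomp (g := Sum.inr) Sum.inr_injective
  refine ⟨fun s => by fun_prop, by fun_prop, ?_⟩
  -- By Lévy's continuity theorem it suffices to treat characteristic functions, which factor over
  -- the two samples.
  refine ProbabilityMeasure.tendsto_iff_tendsto_charFun.2 fun t => ?_
  simp only [ProbabilityMeasure.coe_mk, Measure.map_id]
  have hlim := (key hUi hUm hU hU2 hn ha t).mul (key hVi hVm hV hV2 hm hb t)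
  convert! hlim using 2 with s
  · have hind : IndepFun (fun ω => ∑ k ∈ Finset.range (n s), U k ω)
        (fun ω => ∑ k ∈ Finset.range (m s), V k ω) P := by
      -- The two sums use disjoint blocks of the jointly independent family indexed by `ℕ ⊕ ℕ`.
      have hd : Disjoint ((Finset.range (n s)).map (Function.Embedding.inl : ℕ ↪ ℕ ⊕ ℕ))
          ((Finset.range (m s)).map Function.Embedding.inr) := by
        rw [Finset.disjoint_left]; simp
      have h := hindep.indepFun_finset _ _ hd (by rintro (i | i); exacts [hUm i, hVm i])
      have h' := h.comp (φ := fun x => ∑ i, x i) (ψ := fun x => ∑ i, x i)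
        (by fun_prop) (by fun_prop)
      convert! h' using 1
      · ext ω
        simp only [Function.comp]
        rw [Finset.sum_coe_sort ((Finset.range (n s)).map Function.Embedding.inl)
          (fun i => Sum.elim U V i ω)]
        simp
      · ext ω
        simp only [Function.comp]
        rw [Finset.sum_coe_sort ((Finset.range (m s)).map Function.Embedding.inr)
          (fun i => Sum.elim U V i ω)]
        simp
    have hind' := hind.comp (φ := fun x => a s * ((√(n s))⁻¹ * (x - n s * P[U 0])))
      (ψ := fun x => b s * ((√(m s))⁻¹ * (x - m s * P[V 0]))) (by fun_prop) (by fun_prop)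
    have := hind'.charFun_map_fun_add_eq_mul (by fun_prop) (by fun_prop)
    exact congrFun this t
  · rw [charFun_gaussianReal, charFun_gaussianReal, charFun_gaussianReal, ← Complex.exp_add]
    congr 1
    have hv' := congrArg (fun x : ℝ => (x : ℂ)) hv
    push_cast at hv'
    rw [Real.coe_toNNReal _ (variance_nonneg _ _), Real.coe_toNNReal _ (variance_nonneg _ _), hv']
    push_cast
    ring

end TwoSampleCLT

/-! ### Reflection symmetry: from the complex modulus to real functions. -/

section Symmetry

variable {d : ℕ}

/-- For a function with `F (-t) = conj (F t)` and a reflection-invariant measure, the squared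
modulus may be replaced by the square of the sum of real and imaginary part. -/
theorem integral_norm_sq_eq_integral_re_add_im_sq {μ : Measure (EuclideanSpace ℝ (Fin d))}
    [IsFiniteMeasure μ] (hμ : μ.map (fun x => -x) = μ)
    {F : EuclideanSpace ℝ (Fin d) → ℂ} (hF : Continuous F)
    {C : ℝ} (hC : ∀ t, ‖F t‖ ≤ C) (hconj : ∀ t, F (-t) = (starRingEnd ℂ) (F t)) :
    ∫ t, ‖F t‖ ^ 2 ∂μ = ∫ t, ((F t).re + (F t).im) ^ 2 ∂μ := by
  have hre : ∀ t, |(F t).re| ≤ C := fun t => (Complex.abs_re_le_norm _).trans (hC t)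
  have him : ∀ t, |(F t).im| ≤ C := fun t => (Complex.abs_im_le_norm _).trans (hC t)
  -- The integrand is odd and `μ` is even, so the integral equals its own negative.
  have h0 : ∫ t, (F t).re * (F t).im ∂μ = 0 := by
    have h1 : ∫ t, (F t).re * (F t).im ∂μ = ∫ t, (F (-t)).re * (F (-t)).im ∂μ := by
      conv_lhs => rw [← hμ]
      rw [integral_map (by fun_prop) (by fun_prop)]
    simp only [hconj, Complex.conj_re, Complex.conj_im, mul_neg, integral_neg] at h1
    linarith
  have hi1 : Integrable (fun t => ‖F t‖ ^ 2) μ := by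
    refine Integrable.of_bound (by fun_prop) (C ^ 2) (ae_of_all _ fun t => ?_)
    rw [Real.norm_eq_abs, abs_of_nonneg (by positivity)]
    exact pow_le_pow_left₀ (norm_nonneg _) (hC t) 2
  have hi2 : Integrable (fun t => 2 * ((F t).re * (F t).im)) μ := by
    refine Integrable.of_bound (by fun_prop) (2 * (C * C)) (ae_of_all _ fun t => ?_)
    rw [Real.norm_eq_abs, abs_mul, abs_mul, abs_two]
    have := mul_le_mul (hre t) (him t) (abs_nonneg _) ((abs_nonneg _).trans (hre t))
    linarith
  have : ∀ t, ((F t).re + (F t).im) ^ 2 = ‖F t‖ ^ 2 + 2 * ((F t).re * (F t).im) := fun t => by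
    rw [← Complex.normSq_eq_norm_sq, Complex.normSq_apply]; ring
  simp_rw [this]
  rw [integral_add hi1 hi2, integral_const_mul, h0]; simp

end Symmetry

/-! ### Continuity and boundedness of `CS`. -/

section Trig

@[fun_prop]
theorem continuous_CS : Continuous CS := by unfold CS; fun_prop

theorem abs_CS_le (ξ : ℝ) : |CS ξ| ≤ 2 :=
  (abs_add_le _ _).trans (by linarith [Real.abs_cos_le_one ξ, Real.abs_sin_le_one ξ])

end Trig

/-! ### Empirical and population means of `CS`, their mean squared error, and the limiting variance.
-/

section Empirical

variable {d : ℕ} {Ω : Type*}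

/-- The empirical mean of `CS (tᵀ Z_j)` over the first `n` terms. -/
noncomputable def empCS (Z : ℕ → Ω → EuclideanSpace ℝ (Fin d)) (n : ℕ) (ω : Ω)
    (t : EuclideanSpace ℝ (Fin d)) : ℝ :=
  (n : ℝ)⁻¹ * ∑ j ∈ Finset.range n, CS (inner ℝ t (Z j ω))

theorem abs_empCS_le (Z : ℕ → Ω → EuclideanSpace ℝ (Fin d)) (n : ℕ) (ω : Ω)
    (t : EuclideanSpace ℝ (Fin d)) : |empCS Z n ω t| ≤ 2 := by
  unfold empCS
  have h : |∑ j ∈ Finset.range n, CS (inner ℝ t (Z j ω))| ≤ n * 2 :=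
    (Finset.abs_sum_le_sum_abs _ _).trans
      ((Finset.sum_le_sum fun j _ => abs_CS_le _).trans (by simp))
  rw [abs_mul, abs_of_nonneg (by positivity : (0 : ℝ) ≤ (n : ℝ)⁻¹)]
  -- For `n = 0` the inverse is `0` by convention, so the bound still holds.
  rcases Nat.eq_zero_or_pos n with rfl | hn
  · simp
  · have : (0 : ℝ) < n := by exact_mod_cast hn
    rw [inv_mul_le_iff₀ this]; exact h

theorem continuous_empCS (Z : ℕ → Ω → EuclideanSpace ℝ (Fin d)) (n : ℕ) (ω : Ω) :
    Continuous (empCS Z n ω) := by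
  unfold empCS; fun_prop

theorem continuous_empCF (Z : ℕ → Ω → EuclideanSpace ℝ (Fin d)) (n : ℕ) (ω : Ω) :
    Continuous (empCF Z n ω) := by
  unfold empCF; fun_prop

theorem norm_empCF_le (Z : ℕ → Ω → EuclideanSpace ℝ (Fin d)) (n : ℕ) (ω : Ω)
    (t : EuclideanSpace ℝ (Fin d)) : ‖empCF Z n ω t‖ ≤ 1 := by
  unfold empCF
  have h : ‖∑ j ∈ Finset.range n, Complex.exp (Complex.I * ((inner ℝ t (Z j ω) : ℝ) : ℂ))‖ ≤ n :=
    (norm_sum_le _ _).trans (by simp [mul_comm Complex.I, Complex.norm_exp_ofReal_mul_I])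
  rw [norm_mul, norm_div, norm_one, Complex.norm_natCast]
  rcases Nat.eq_zero_or_pos n with rfl | hn
  · simp
  · have : (0 : ℝ) < n := by exact_mod_cast hn
    rw [div_mul_eq_mul_div, one_mul, div_le_one this]; exact h

theorem empCF_neg (Z : ℕ → Ω → EuclideanSpace ℝ (Fin d)) (n : ℕ) (ω : Ω)
    (t : EuclideanSpace ℝ (Fin d)) :
    empCF Z n ω (-t) = (starRingEnd ℂ) (empCF Z n ω t) := by
  simp [empCF, ← Complex.exp_conj]

theorem empCF_re_add_im (Z : ℕ → Ω → EuclideanSpace ℝ (Fin d)) (n : ℕ) (ω : Ω)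
    (t : EuclideanSpace ℝ (Fin d)) :
    (empCF Z n ω t).re + (empCF Z n ω t).im = empCS Z n ω t := by
  have h : empCF Z n ω t = (((n : ℝ)⁻¹ : ℝ) : ℂ) *
      ∑ j ∈ Finset.range n, Complex.exp ((inner ℝ t (Z j ω) : ℝ) * Complex.I) := by
    simp [empCF, mul_comm Complex.I]
  rw [h, Complex.re_ofReal_mul, Complex.im_ofReal_mul, Complex.re_sum, Complex.im_sum]
  simp only [Complex.exp_ofReal_mul_I_re, Complex.exp_ofReal_mul_I_im]
  rw [← mul_add, ← Finset.sum_add_distrib]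
  rfl

variable {μ : Measure (EuclideanSpace ℝ (Fin d))} [IsFiniteMeasure μ]

theorem statT_eq (hμ : μ.map (fun x => -x) = μ) {M : Set (EuclideanSpace ℝ (Fin d))} (hM : μ Mᶜ = 0)
    (X Y : ℕ → Ω → EuclideanSpace ℝ (Fin d)) (n m : ℕ) (ω : Ω) :
    statT M μ X Y n m ω =
      ((n : ℝ) * m / ((n : ℝ) + m)) * ∫ t, (empCS X n ω t - empCS Y m ω t) ^ 2 ∂μ := by
  unfold statT
  rw [Measure.restrict_eq_self_of_ae_mem (by simpa [mem_ae_iff] using hM),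
    integral_norm_sq_eq_integral_re_add_im_sq hμ (C := 2)
      (F := fun t => empCF X n ω t - empCF Y m ω t)
      ((continuous_empCF X n ω).sub (continuous_empCF Y m ω))]
  · simp_rw [← empCF_re_add_im, Complex.sub_re, Complex.sub_im, add_sub_add_comm]
  · intro t
    exact (norm_sub_le _ _).trans (by linarith [norm_empCF_le X n ω t, norm_empCF_le Y m ω t])
  · intro t; rw [empCF_neg, empCF_neg, map_sub]

/-- The function `x ↦ 2 ∫ z(t) CS(tᵀ x) μ(dt)` whose centered sums give the linear part of the
statistic. -/
noncomputable def proj (μ : Measure (EuclideanSpace ℝ (Fin d))) (z : EuclideanSpace ℝ (Fin d) → ℝ)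
    (x : EuclideanSpace ℝ (Fin d)) : ℝ :=
  2 * ∫ t, z t * CS (inner ℝ t x) ∂μ

theorem measurable_proj {z : EuclideanSpace ℝ (Fin d) → ℝ} (hz : Measurable z) :
    Measurable (proj μ z) := by
  unfold proj
  have : StronglyMeasurable (Function.uncurry fun (x t : EuclideanSpace ℝ (Fin d)) =>
      z t * CS (inner ℝ t x)) := by
    apply Measurable.stronglyMeasurable; unfold Function.uncurry; fun_prop
  exact (this.integral_prod_right (ν := μ)).measurable.const_mul 2

theorem abs_proj_le {z : EuclideanSpace ℝ (Fin d) → ℝ} {C : ℝ} (hC : ∀ t, |z t| ≤ C)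
    (x : EuclideanSpace ℝ (Fin d)) :
    |proj μ z x| ≤ 2 * (C * 2 * μ.real Set.univ) := by
  unfold proj
  rw [abs_mul, abs_two]
  gcongr
  refine norm_integral_le_of_norm_le_const (μ := μ) (f := fun t => z t * CS (inner ℝ t x))
    (ae_of_all _ fun t => ?_)
  rw [Real.norm_eq_abs, abs_mul]
  exact mul_le_mul (hC t) (abs_CS_le _) (abs_nonneg _) ((abs_nonneg _).trans (hC t))

theorem integrable_mul_CS {z : EuclideanSpace ℝ (Fin d) → ℝ} (hz : Measurable z) {C : ℝ}
    (hC : ∀ t, |z t| ≤ C) (x : EuclideanSpace ℝ (Fin d)) :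
    Integrable (fun t => z t * CS (inner ℝ t x)) μ := by
  refine Integrable.of_bound (by fun_prop) (C * 2) (ae_of_all _ fun t => ?_)
  rw [Real.norm_eq_abs, abs_mul]
  exact mul_le_mul (hC t) (abs_CS_le _) (abs_nonneg _) ((abs_nonneg _).trans (hC t))

/-- Pairing the empirical process with `z` reduces it to an average of scalars, to which the
one-dimensional limit theorem applies. -/
theorem two_mul_integral_empCS {z : EuclideanSpace ℝ (Fin d) → ℝ} (hz : Measurable z) {C : ℝ}
    (hC : ∀ t, |z t| ≤ C)
    (Z : ℕ → Ω → EuclideanSpace ℝ (Fin d)) (n : ℕ) (ω : Ω) :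
    2 * ∫ t, z t * empCS Z n ω t ∂μ = (n : ℝ)⁻¹ * ∑ j ∈ Finset.range n, proj μ z (Z j ω) := by
  have h : ∀ t, z t * empCS Z n ω t =
      (n : ℝ)⁻¹ * ∑ j ∈ Finset.range n, z t * CS (inner ℝ t (Z j ω)) := fun t => by
    rw [empCS, ← Finset.mul_sum, mul_left_comm]
  simp_rw [h, proj]
  rw [integral_const_mul, integral_finsetSum _ fun j _ => integrable_mul_CS hz hC _,
    ← Finset.mul_sum, mul_left_comm]

variable [MeasurableSpace Ω]

theorem measurable_empCS {Z : ℕ → Ω → EuclideanSpace ℝ (Fin d)} (hZ : ∀ j, Measurable (Z j))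
    (n : ℕ) : Measurable fun p : Ω × EuclideanSpace ℝ (Fin d) => empCS Z n p.1 p.2 := by
  unfold empCS; fun_prop

theorem measurable_empCS_apply {Z : ℕ → Ω → EuclideanSpace ℝ (Fin d)} (hZ : ∀ j, Measurable (Z j))
    (n : ℕ) (t : EuclideanSpace ℝ (Fin d)) : Measurable fun ω => empCS Z n ω t := by
  unfold empCS; fun_prop

variable {P : Measure Ω} [IsProbabilityMeasure P]

theorem charFun_re_add_im {Z : Ω → EuclideanSpace ℝ (Fin d)} (hZ : Measurable Z)
    (t : EuclideanSpace ℝ (Fin d)) :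
    (charFun (P.map Z) t).re + (charFun (P.map Z) t).im = meanCS P Z t := by
  have hi : Integrable (fun ω => Complex.exp ((inner ℝ (Z ω) t : ℝ) * Complex.I)) P := by
    refine Integrable.of_bound (by fun_prop) 1 (ae_of_all _ fun ω => ?_)
    rw [Complex.norm_exp_ofReal_mul_I]
  rw [charFun_apply, integral_map (by fun_prop) (by fun_prop)]
  have h1 := integral_re hi
  have h2 := integral_im hi
  simp only [RCLike.re_to_complex, RCLike.im_to_complex, Complex.exp_ofReal_mul_I_re,
    Complex.exp_ofReal_mul_I_im] at h1 h2
  rw [← h1, ← h2, ← integral_add]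
  · simp only [meanCS, CS, real_inner_comm]
  · exact Integrable.of_bound (by fun_prop) 1 (ae_of_all _ fun ω => Real.abs_cos_le_one _)
  · exact Integrable.of_bound (by fun_prop) 1 (ae_of_all _ fun ω => Real.abs_sin_le_one _)

theorem continuous_meanCS {Z : Ω → EuclideanSpace ℝ (Fin d)} (hZ : Measurable Z) :
    Continuous (meanCS P Z) := by
  have : IsProbabilityMeasure (P.map Z) := Measure.isProbabilityMeasure_map hZ.aemeasurable
  have h : Continuous (charFun (P.map Z)) := continuous_charFun
  have : meanCS P Z = fun t => (charFun (P.map Z) t).re + (charFun (P.map Z) t).im :=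
    funext fun t => (charFun_re_add_im hZ t).symm
  rw [this]; fun_prop

theorem abs_meanCS_le (Z : Ω → EuclideanSpace ℝ (Fin d)) (t : EuclideanSpace ℝ (Fin d)) :
    |meanCS P Z t| ≤ 2 := by
  have := norm_integral_le_of_norm_le_const (μ := P) (f := fun ω => CS (inner ℝ t (Z ω))) (C := 2)
    (ae_of_all _ fun ω => abs_CS_le _)
  simpa [meanCS] using this

theorem continuous_zFun {X Y : Ω → EuclideanSpace ℝ (Fin d)} (hX : Measurable X)
    (hY : Measurable Y) : Continuous (zFun P X Y) :=
  (continuous_meanCS hX).sub (continuous_meanCS hY)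

theorem abs_zFun_le (X Y : Ω → EuclideanSpace ℝ (Fin d)) (t : EuclideanSpace ℝ (Fin d)) :
    |zFun P X Y t| ≤ 4 :=
  (abs_sub _ _).trans (by linarith [abs_meanCS_le (P := P) X t, abs_meanCS_le (P := P) Y t])

theorem deviation_eq (hμ : μ.map (fun x => -x) = μ) {M : Set (EuclideanSpace ℝ (Fin d))}
    (hM : μ Mᶜ = 0)
    {X Y : Ω → EuclideanSpace ℝ (Fin d)} (hX : Measurable X) (hY : Measurable Y) :
    deviation M μ P X Y = ∫ t, zFun P X Y t ^ 2 ∂μ := by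
  have : IsProbabilityMeasure (P.map X) := Measure.isProbabilityMeasure_map hX.aemeasurable
  have : IsProbabilityMeasure (P.map Y) := Measure.isProbabilityMeasure_map hY.aemeasurable
  unfold deviation
  rw [Measure.restrict_eq_self_of_ae_mem (by simpa [mem_ae_iff] using hM),
    integral_norm_sq_eq_integral_re_add_im_sq hμ (C := 2)
      (F := fun t => charFun (P.map X) t - charFun (P.map Y) t)
      (continuous_charFun.sub continuous_charFun)]
  · simp_rw [zFun, ← charFun_re_add_im hX, ← charFun_re_add_im hY, Complex.sub_re, Complex.sub_im,
      add_sub_add_comm]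
  · intro t
    exact (norm_sub_le _ _).trans (by
      linarith [norm_charFun_le_one (μ := P.map X) t, norm_charFun_le_one (μ := P.map Y) t])
  · intro t; rw [charFun_neg, charFun_neg, map_sub]

/-- The mean squared error of `empCS` is `O(1/n)`. -/
theorem integral_empCS_sub_meanCS_sq_le {Z : ℕ → Ω → EuclideanSpace ℝ (Fin d)}
    (hZ : ∀ j, Measurable (Z j))
    (hind : iIndepFun Z P) (hid : ∀ j, IdentDistrib (Z j) (Z 0) P P) {n : ℕ} (hn : 0 < n)
    (t : EuclideanSpace ℝ (Fin d)) :
    ∫ ω, (empCS Z n ω t - meanCS P (Z 0) t) ^ 2 ∂P ≤ 4 / n := by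
  have hn' : (n : ℝ) ≠ 0 := by exact_mod_cast hn.ne'
  let W : ℕ → Ω → ℝ := fun j ω => CS (inner ℝ t (Z j ω))
  have hWm : ∀ j, Measurable (W j) := fun j => by fun_prop
  have hW2 : ∀ j, MemLp (W j) 2 P := fun j =>
    MemLp.of_bound (by fun_prop) 2 (ae_of_all _ fun ω => abs_CS_le _)
  have hWid : ∀ j, IdentDistrib (W j) (W 0) P P := fun j =>
    (hid j).comp (u := fun x => CS (inner ℝ t x)) (by fun_prop)
  have hWind : iIndepFun W P := hind.comp (fun _ x => CS (inner ℝ t x)) (fun _ => by fun_prop)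
  have hmean : ∫ ω, empCS Z n ω t ∂P = meanCS P (Z 0) t := by
    change ∫ ω, (n : ℝ)⁻¹ * ∑ j ∈ Finset.range n, W j ω ∂P = ∫ ω, W 0 ω ∂P
    rw [integral_const_mul, integral_finsetSum _ fun j _ => (hW2 j).integrable (by simp)]
    simp_rw [fun j => (hWid j).integral_eq]
    simp [hn']
  have hvar : Var[fun ω => empCS Z n ω t; P] = (n : ℝ)⁻¹ * Var[W 0; P] := by
    change Var[fun ω => (n : ℝ)⁻¹ * ∑ j ∈ Finset.range n, W j ω; P] = _
    rw [variance_const_mul]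
    have := IndepFun.variance_sum (s := Finset.range n) (fun j _ => hW2 j)
      (fun i _ j _ hij => hWind.indepFun hij)
    have h2 : (fun ω => ∑ j ∈ Finset.range n, W j ω) = ∑ j ∈ Finset.range n, W j := by
      ext; simp
    rw [h2, this, Finset.sum_congr rfl fun j _ => (hWid j).variance_eq]
    simp; field_simp
  have hle : Var[W 0; P] ≤ 4 := by
    -- Popoviciu's inequality: values in `[-2, 2]` force variance at most `((2 - (-2)) / 2)² = 4`.
    have := variance_le_sq_of_bounded (μ := P) (X := W 0) (a := -2) (b := 2)
      (ae_of_all _ fun ω => abs_le.1 (abs_CS_le _)) (by fun_prop)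
    norm_num at this; exact this
  have hm : Measurable fun ω => empCS Z n ω t := measurable_empCS_apply hZ n t
  rw [← hmean, ← variance_eq_integral hm.aemeasurable, hvar, div_eq_inv_mul]
  gcongr

/-- Fubini reduces this to a bound for each `t`. There the error is a difference of two centred
means, so `(a - b)² ≤ 2a² + 2b²` and the mean squared errors `4/n`, `4/m` give the constant `8`. -/
theorem integral_integral_sq_le {X Y : ℕ → Ω → EuclideanSpace ℝ (Fin d)}
    (hX : ∀ j, Measurable (X j))
    (hY : ∀ j, Measurable (Y j)) (hXi : iIndepFun X P) (hYi : iIndepFun Y P)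
    (hXd : ∀ j, IdentDistrib (X j) (X 0) P P) (hYd : ∀ j, IdentDistrib (Y j) (Y 0) P P)
    {n m : ℕ} (hn : 0 < n) (hm : 0 < m) :
    ∫ ω, ∫ t, (empCS X n ω t - empCS Y m ω t - zFun P (X 0) (Y 0) t) ^ 2 ∂μ ∂P ≤
      8 * μ.real Set.univ * ((n : ℝ)⁻¹ + (m : ℝ)⁻¹) := by
  have mX := measurable_empCS hX n
  have mY := measurable_empCS hY m
  have mz := (continuous_zFun (P := P) (hX 0) (hY 0)).measurable
  rw [integral_integral_swap]
  · have hb : ∀ t, ∫ ω, (empCS X n ω t - empCS Y m ω t - zFun P (X 0) (Y 0) t) ^ 2 ∂P ≤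
        8 * ((n : ℝ)⁻¹ + (m : ℝ)⁻¹) := by
      intro t
      have mXt : Measurable fun ω => empCS X n ω t := measurable_empCS_apply hX n t
      have mYt : Measurable fun ω => empCS Y m ω t := measurable_empCS_apply hY m t
      have hx : Integrable (fun ω => 2 * (empCS X n ω t - meanCS P (X 0) t) ^ 2) P := by
        refine Integrable.of_bound (by fun_prop) (2 * 4 ^ 2) (ae_of_all _ fun ω => ?_)
        have := abs_sub (empCS X n ω t) (meanCS P (X 0) t)
        rw [Real.norm_eq_abs, abs_of_nonneg (by positivity), ← sq_abs (_ - _)]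
        gcongr
        linarith [abs_empCS_le X n ω t, abs_meanCS_le (P := P) (X 0) t]
      have hy : Integrable (fun ω => 2 * (empCS Y m ω t - meanCS P (Y 0) t) ^ 2) P := by
        refine Integrable.of_bound (by fun_prop) (2 * 4 ^ 2) (ae_of_all _ fun ω => ?_)
        have := abs_sub (empCS Y m ω t) (meanCS P (Y 0) t)
        rw [Real.norm_eq_abs, abs_of_nonneg (by positivity), ← sq_abs (_ - _)]
        gcongr
        linarith [abs_empCS_le Y m ω t, abs_meanCS_le (P := P) (Y 0) t]
      have h1 : ∫ ω, (empCS X n ω t - empCS Y m ω t - zFun P (X 0) (Y 0) t) ^ 2 ∂P ≤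
          ∫ ω, (2 * (empCS X n ω t - meanCS P (X 0) t) ^ 2 +
            2 * (empCS Y m ω t - meanCS P (Y 0) t) ^ 2) ∂P := by
        refine integral_mono_of_nonneg (ae_of_all _ fun ω => sq_nonneg _) (hx.add hy)
          (ae_of_all _ fun ω => ?_)
        simp only [zFun]
        nlinarith [sq_nonneg ((empCS X n ω t - meanCS P (X 0) t) +
          (empCS Y m ω t - meanCS P (Y 0) t))]
      rw [integral_add hx hy, integral_const_mul, integral_const_mul] at h1
      have h2 := integral_empCS_sub_meanCS_sq_le hX hXi hXd hn t
      have h3 := integral_empCS_sub_meanCS_sq_le hY hYi hYd hm t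
      rw [div_eq_mul_inv] at h2 h3
      linarith
    refine (integral_mono_of_nonneg (ae_of_all _ fun t => integral_nonneg fun ω => sq_nonneg _)
      (integrable_const _) (ae_of_all _ hb)).trans_eq ?_
    rw [integral_const, smul_eq_mul]; ring
  -- Here `8 = 2 + 2 + 4` adds the bounds on the two empirical means and on `z`.
  · refine Integrable.of_bound (C := 8 ^ 2) ?_ (ae_of_all _ fun p => ?_)
    · have : Measurable fun p : Ω × EuclideanSpace ℝ (Fin d) => zFun P (X 0) (Y 0) p.2 :=
        mz.comp measurable_snd
      exact (((mX.sub mY).sub this).pow_const 2).aestronglyMeasurable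
    · simp only [Function.uncurry]
      rw [Real.norm_eq_abs, abs_of_nonneg (by positivity), ← sq_abs]
      gcongr
      refine (abs_sub _ _).trans ?_
      linarith [abs_sub (empCS X n p.1 p.2) (empCS Y m p.1 p.2), abs_empCS_le X n p.1 p.2,
        abs_empCS_le Y m p.1 p.2, abs_zFun_le (P := P) (X 0) (Y 0) p.2]

theorem integral_proj {z : EuclideanSpace ℝ (Fin d) → ℝ} (hz : Measurable z) {C : ℝ}
    (hC : ∀ t, |z t| ≤ C)
    {Z : Ω → EuclideanSpace ℝ (Fin d)} (hZ : Measurable Z) :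
    ∫ ω, proj μ z (Z ω) ∂P = 2 * ∫ t, z t * meanCS P Z t ∂μ := by
  unfold proj meanCS
  rw [integral_const_mul, integral_integral_swap]
  · simp_rw [integral_const_mul]
  · refine Integrable.of_bound (C := C * 2) ?_ (ae_of_all _ fun p => ?_)
    · unfold Function.uncurry
      have : Measurable fun p : Ω × EuclideanSpace ℝ (Fin d) =>
          z p.2 * CS (inner ℝ p.2 (Z p.1)) := by
        fun_prop
      exact this.aestronglyMeasurable
    · simp only [Function.uncurry, Real.norm_eq_abs, abs_mul]
      exact mul_le_mul (hC _) (abs_CS_le _) (abs_nonneg _) ((abs_nonneg _).trans (hC p.2))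

/-- The variance of `proj μ z (Z)` as a double integral of the covariance kernel. -/
theorem variance_proj {z : EuclideanSpace ℝ (Fin d) → ℝ} (hz : Measurable z) {C : ℝ}
    (hC : ∀ t, |z t| ≤ C)
    {Z : Ω → EuclideanSpace ℝ (Fin d)} (hZ : Measurable Z) :
    Var[fun ω => proj μ z (Z ω); P] = 4 * ∫ t, ∫ s, covCS P Z s t * z s * z t ∂μ ∂μ := by
  have mmean := (continuous_meanCS (P := P) hZ).measurable
  let c : Ω → EuclideanSpace ℝ (Fin d) → ℝ := fun ω t => z t * (CS (inner ℝ t (Z ω)) - meanCS P Z t)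
  have hcm : Measurable fun p : Ω × EuclideanSpace ℝ (Fin d) => c p.1 p.2 := by
    have : Measurable fun p : Ω × EuclideanSpace ℝ (Fin d) => meanCS P Z p.2 :=
        mmean.comp measurable_snd
    fun_prop
  have hcb : ∀ ω t, |c ω t| ≤ C * 4 := fun ω t => by
    have h1 := abs_sub (CS (inner ℝ t (Z ω))) (meanCS P Z t)
    rw [abs_mul]
    exact mul_le_mul (hC t) (by linarith [abs_CS_le (inner ℝ t (Z ω)), abs_meanCS_le (P := P) Z t])
      (abs_nonneg _) ((abs_nonneg _).trans (hC t))
  have hcen : ∀ ω, proj μ z (Z ω) - ∫ ω', proj μ z (Z ω') ∂P = 2 * ∫ t, c ω t ∂μ := fun ω => by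
    rw [integral_proj hz hC hZ, proj, ← mul_sub, ← integral_sub (integrable_mul_CS hz hC _)]
    · simp only [c, mul_sub]
    · refine Integrable.of_bound (by fun_prop) (C * 2) (ae_of_all _ fun t => ?_)
      rw [Real.norm_eq_abs, abs_mul]
      exact mul_le_mul (hC t) (abs_meanCS_le _ _) (abs_nonneg _) ((abs_nonneg _).trans (hC t))
  have hC0 : 0 ≤ C := (abs_nonneg _).trans (hC 0)
  have hprod : ∀ ω s t, |c ω s * c ω t| ≤ (C * 4) * (C * 4) := fun ω s t => by
    rw [abs_mul]
    exact mul_le_mul (hcb ω s) (hcb ω t) (abs_nonneg _) (by positivity)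
  have mproj : Measurable fun ω => proj μ z (Z ω) := (measurable_proj hz).comp hZ
  rw [variance_eq_integral mproj.aemeasurable]
  simp_rw [hcen, mul_pow]
  rw [integral_const_mul]
  norm_num only
  congr 1
  -- The squared integral becomes an integral over `μ.prod μ`, so that Fubini can move the
  -- expectation inside, where it produces the covariance kernel.
  have hsq : ∀ ω, (∫ t, c ω t ∂μ) ^ 2 = ∫ p : _ × _, c ω p.1 * c ω p.2 ∂(μ.prod μ) := fun ω => by
    rw [integral_prod_mul, sq]
  have hjoint : Measurable fun q : Ω × (EuclideanSpace ℝ (Fin d) × EuclideanSpace ℝ (Fin d)) =>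
      c q.1 q.2.1 * c q.1 q.2.2 :=
    (hcm.comp (measurable_fst.prodMk measurable_snd.fst)).mul
      (hcm.comp (measurable_fst.prodMk measurable_snd.snd))
  have hcov : ∀ s t, ∫ ω, c ω s * c ω t ∂P = covCS P Z s t * z s * z t := fun s t => by
    rw [covCS, covariance, ← integral_mul_const, ← integral_mul_const]
    refine integral_congr_ae (ae_of_all _ fun ω => ?_)
    simp only [c, meanCS]; ring
  simp_rw [hsq]
  rw [integral_integral_swap]
  · rw [integral_prod_symm]
    · simp_rw [hcov]
    · refine Integrable.of_bound (C := (C * 4) * (C * 4)) ?_ (ae_of_all _ fun p => ?_)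
      · exact (hjoint.stronglyMeasurable.integral_prod_left (μ := P)).aestronglyMeasurable
      · have := norm_integral_le_of_norm_le_const (μ := P) (f := fun ω => c ω p.1 * c ω p.2)
          (ae_of_all _ fun ω => hprod ω p.1 p.2)
        simpa using this
  · exact Integrable.of_bound hjoint.aestronglyMeasurable ((C * 4) * (C * 4))
      (ae_of_all _ fun q => hprod _ _ _)

/-- The limiting variance is the convex combination of the variances of the two projections. -/
theorem sigmaSq_eq {X Y : Ω → EuclideanSpace ℝ (Fin d)} (hX : Measurable X) (hY : Measurable Y)
    {M : Set (EuclideanSpace ℝ (Fin d))}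
    (hM : μ Mᶜ = 0) (τ : ℝ) :
    sigmaSq M μ P X Y τ = τ * Var[fun ω => proj μ (zFun P X Y) (X ω); P] +
      (1 - τ) * Var[fun ω => proj μ (zFun P X Y) (Y ω); P] := by
  have hz := (continuous_zFun (P := P) hX hY).measurable
  have hC := abs_zFun_le (P := P) X Y
  have hint : ∀ {Z : Ω → EuclideanSpace ℝ (Fin d)} (_ : Measurable Z),
      Integrable (fun p : EuclideanSpace ℝ (Fin d) × EuclideanSpace ℝ (Fin d) =>
        covCS P Z p.2 p.1 * zFun P X Y p.2 * zFun P X Y p.1) (μ.prod μ) := by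
    intro Z hZ
    have mmean := (continuous_meanCS (P := P) hZ).measurable
    refine Integrable.of_bound (C := (4 * 4) * 4 * 4) ?_ (ae_of_all _ fun p => ?_)
    · have hcm : Measurable fun q : Ω × (EuclideanSpace ℝ (Fin d) × EuclideanSpace ℝ (Fin d)) =>
          (CS (inner ℝ q.2.2 (Z q.1)) - meanCS P Z q.2.2) *
          (CS (inner ℝ q.2.1 (Z q.1)) - meanCS P Z q.2.1) := by
        have h1 : Measurable fun q : Ω × (EuclideanSpace ℝ (Fin d) × EuclideanSpace ℝ (Fin d)) =>
            meanCS P Z q.2.2 :=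
          mmean.comp measurable_snd.snd
        have h2 : Measurable fun q : Ω × (EuclideanSpace ℝ (Fin d) × EuclideanSpace ℝ (Fin d)) =>
            meanCS P Z q.2.1 :=
          mmean.comp measurable_snd.fst
        fun_prop
      have hcov : Measurable fun p : EuclideanSpace ℝ (Fin d) × EuclideanSpace ℝ (Fin d) =>
          covCS P Z p.2 p.1 :=
        (hcm.stronglyMeasurable.integral_prod_left (μ := P)).measurable
      exact ((hcov.mul (hz.comp measurable_snd)).mul (hz.comp measurable_fst)).aestronglyMeasurable
    · have hcovb : |covCS P Z p.2 p.1| ≤ 4 * 4 := by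
        have hb : ∀ ω t, |CS (inner ℝ t (Z ω)) - meanCS P Z t| ≤ 4 := fun ω t =>
          (abs_sub _ _).trans
            (by linarith [abs_CS_le (inner ℝ t (Z ω)), abs_meanCS_le (P := P) Z t])
        have := norm_integral_le_of_norm_le_const (μ := P) (C := 4 * 4)
          (f := fun ω => (CS (inner ℝ p.2 (Z ω)) - meanCS P Z p.2) *
            (CS (inner ℝ p.1 (Z ω)) - meanCS P Z p.1)) (ae_of_all _ fun ω => by
              rw [Real.norm_eq_abs, abs_mul]
              exact mul_le_mul (hb _ _) (hb _ _) (abs_nonneg _) (by norm_num))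
        simpa [covCS, covariance, meanCS] using this
      rw [Real.norm_eq_abs, abs_mul, abs_mul]
      gcongr
      · exact hC _
      · exact hC _
  rw [variance_proj hz hC hX, variance_proj hz hC hY, sigmaSq]
  rw [Measure.restrict_eq_self_of_ae_mem (by simpa [mem_ae_iff] using hM)]
  -- Linearity in the kernel is applied on the product space, where integrability is known, and then
  -- transferred back to iterated integrals.
  have h1 := integral_prod _ (hint hX)
  have h2 := integral_prod _ (hint hY)
  have h3 := integral_prod _ (((hint hX).const_mul τ).add ((hint hY).const_mul (1 - τ)))
  simp only [Pi.add_apply] at h1 h2 h3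
  rw [integral_add ((hint hX).const_mul τ) ((hint hY).const_mul (1 - τ)), integral_const_mul,
    integral_const_mul, h1, h2] at h3
  have h4 : ∀ s t, Kstar P X Y τ s t * zFun P X Y s * zFun P X Y t =
      τ * (covCS P X s t * zFun P X Y s * zFun P X Y t) +
      (1 - τ) * (covCS P Y s t * zFun P X Y s * zFun P X Y t) := fun s t => by
    unfold Kstar; ring
  simp_rw [h4]
  rw [← h3]
  ring

end Empirical

/-! ### Linear part plus quadratic remainder. -/

section Decomposition

variable {d : ℕ} {Ω : Type*} [MeasurableSpace Ω] {P : Measure Ω} [IsProbabilityMeasure P]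
  {μ : Measure (EuclideanSpace ℝ (Fin d))} [IsFiniteMeasure μ]

theorem measurable_statT {M : Set (EuclideanSpace ℝ (Fin d))}
    (hμ : μ.map (fun x => -x) = μ) (hM : μ Mᶜ = 0) {X Y : ℕ → Ω → EuclideanSpace ℝ (Fin d)}
    (hX : ∀ j, Measurable (X j)) (hY : ∀ j, Measurable (Y j)) (n m : ℕ) :
    Measurable (statT M μ X Y n m) := by
  have h : statT M μ X Y n m = fun ω => _ := funext fun ω => statT_eq hμ hM X Y n m ω
  rw [h]
  have hm : Measurable fun p : Ω × EuclideanSpace ℝ (Fin d) =>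
      (empCS X n p.1 p.2 - empCS Y m p.1 p.2) ^ 2 :=
    ((measurable_empCS hX n).sub (measurable_empCS hY m)).pow_const 2
  exact (hm.stronglyMeasurable.integral_prod_right (ν := μ)).measurable.const_mul _

/-- Expansion of the `L²` norm of the empirical difference around the limit `z`: a linear term,
which is a difference of centered means, plus a quadratic remainder. -/
theorem integral_sq_sub_integral_sq {X Y : ℕ → Ω → EuclideanSpace ℝ (Fin d)}
    (hX : ∀ j, Measurable (X j)) (hY : ∀ j, Measurable (Y j)) (n m : ℕ) (ω : Ω) :
    ∫ t, (empCS X n ω t - empCS Y m ω t) ^ 2 ∂μ - ∫ t, zFun P (X 0) (Y 0) t ^ 2 ∂μ =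
      ((n : ℝ)⁻¹ * ∑ j ∈ Finset.range n, proj μ (zFun P (X 0) (Y 0)) (X j ω) -
        ∫ ω', proj μ (zFun P (X 0) (Y 0)) (X 0 ω') ∂P) -
      ((m : ℝ)⁻¹ * ∑ j ∈ Finset.range m, proj μ (zFun P (X 0) (Y 0)) (Y j ω) -
        ∫ ω', proj μ (zFun P (X 0) (Y 0)) (Y 0 ω') ∂P) +
      ∫ t, (empCS X n ω t - empCS Y m ω t - zFun P (X 0) (Y 0) t) ^ 2 ∂μ := by
  have hzc := continuous_zFun (P := P) (hX 0) (hY 0)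
  have hC := abs_zFun_le (P := P) (X 0) (Y 0)
  rw [← two_mul_integral_empCS hzc.measurable hC, ← two_mul_integral_empCS hzc.measurable hC,
    integral_proj hzc.measurable hC (hX 0), integral_proj hzc.measurable hC (hY 0)]
  have hi : ∀ {u w : EuclideanSpace ℝ (Fin d) → ℝ} (_ : Continuous u) (_ : Continuous w)
      (_ : ∀ t, |u t| ≤ 4) (_ : ∀ t, |w t| ≤ 4), Integrable (fun t => u t * w t) μ := by
    intro u w hu hw hub hwb
    refine Integrable.of_bound (by fun_prop) (4 * 4) (ae_of_all _ fun t => ?_)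
    rw [Real.norm_eq_abs, abs_mul]
    exact mul_le_mul (hub t) (hwb t) (abs_nonneg _) (by norm_num)
  have cX := continuous_empCS X n ω
  have cY := continuous_empCS Y m ω
  have cx := continuous_meanCS (P := P) (hX 0)
  have cy := continuous_meanCS (P := P) (hY 0)
  have bX : ∀ t, |empCS X n ω t| ≤ 4 := fun t => (abs_empCS_le X n ω t).trans (by norm_num)
  have bY : ∀ t, |empCS Y m ω t| ≤ 4 := fun t => (abs_empCS_le Y m ω t).trans (by norm_num)
  have bx : ∀ t, |meanCS P (X 0) t| ≤ 4 := fun t => (abs_meanCS_le _ t).trans (by norm_num)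
  have bY' : ∀ t, |meanCS P (Y 0) t| ≤ 4 := fun t => (abs_meanCS_le _ t).trans (by norm_num)
  have bA : ∀ t, |empCS X n ω t - empCS Y m ω t| ≤ 4 := fun t =>
    (abs_sub _ _).trans (by linarith [abs_empCS_le X n ω t, abs_empCS_le Y m ω t])
  have i1 := hi hzc cX hC bX
  have i2 := hi hzc cY hC bY
  have i3 := hi hzc cx hC bx
  have i4 := hi hzc cy hC bY'
  have i5 := hi (cX.sub cY) (cX.sub cY) bA bA
  have i6 := hi hzc hzc hC hC
  have e : ∀ t, (empCS X n ω t - empCS Y m ω t - zFun P (X 0) (Y 0) t) ^ 2 =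
      ((empCS X n ω t - empCS Y m ω t) * (empCS X n ω t - empCS Y m ω t)
        + zFun P (X 0) (Y 0) t * zFun P (X 0) (Y 0) t)
      - 2 * (zFun P (X 0) (Y 0) t * empCS X n ω t - zFun P (X 0) (Y 0) t * empCS Y m ω t) :=
    fun t => by ring
  -- Because `z = ϱ - b`, the centring constants of the two averages differ by exactly `2 ∫ z²`.
  have e2 : ∫ t, zFun P (X 0) (Y 0) t * zFun P (X 0) (Y 0) t ∂μ =
      ∫ t, zFun P (X 0) (Y 0) t * meanCS P (X 0) t ∂μ -
      ∫ t, zFun P (X 0) (Y 0) t * meanCS P (Y 0) t ∂μ := by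
    rw [← integral_sub i3 i4]
    refine integral_congr_ae (ae_of_all _ fun t => ?_)
    simp only [zFun]; ring
  have e3 := integral_sub (i5.add i6) ((i1.sub i2).const_mul 2)
  have e4 := integral_add i5 i6
  have e5 := integral_sub i1 i2
  simp only [Pi.add_apply, Pi.sub_apply, integral_const_mul] at e3 e4 e5
  simp_rw [e]
  simp only [pow_two]
  linarith

/-- Matches the weight and `1/√p` normalization of the central limit theorem with the common factor
`√(qp/(q+p))` times the `1/p` of an average. -/
theorem sqrt_harmonic_mul_inv {p q : ℝ} (hp : 0 < p) (hq : 0 < q) :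
    √(q / (q + p)) * (√p)⁻¹ = √(q * p / (q + p)) * p⁻¹ := by
  have h : q * p / (q + p) = q / (q + p) * p := by ring
  rw [h, Real.sqrt_mul (by positivity), mul_assoc, ← div_eq_mul_inv √p, Real.sqrt_div_self',
    one_div]

/-- The normalized statistic is the difference of two normalized sums of independent random
variables up to a nonnegative quadratic remainder. -/
theorem normalized_statT_sub {M : Set (EuclideanSpace ℝ (Fin d))}
    (hμ : μ.map (fun x => -x) = μ) (hM : μ Mᶜ = 0) {X Y : ℕ → Ω → EuclideanSpace ℝ (Fin d)}
    (hX : ∀ j, Measurable (X j)) (hY : ∀ j, Measurable (Y j)) {n m : ℕ} (hn : 0 < n) (hm : 0 < m)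
    (ω : Ω) :
    √((m : ℝ) * n / ((m : ℝ) + n)) *
        (statT M μ X Y n m ω / ((m : ℝ) * n / ((m : ℝ) + n)) - deviation M μ P (X 0) (Y 0)) -
      (√((m : ℝ) / (m + n)) * ((√n)⁻¹ *
          (∑ j ∈ Finset.range n, proj μ (zFun P (X 0) (Y 0)) (X j ω) -
            n * ∫ ω', proj μ (zFun P (X 0) (Y 0)) (X 0 ω') ∂P)) +
        -√((n : ℝ) / (n + m)) * ((√m)⁻¹ *
          (∑ j ∈ Finset.range m, proj μ (zFun P (X 0) (Y 0)) (Y j ω) -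
            m * ∫ ω', proj μ (zFun P (X 0) (Y 0)) (Y 0 ω') ∂P))) =
      √((m : ℝ) * n / ((m : ℝ) + n)) *
        ∫ t, (empCS X n ω t - empCS Y m ω t - zFun P (X 0) (Y 0) t) ^ 2 ∂μ := by
  have hn' : (0 : ℝ) < n := by exact_mod_cast hn
  have hm' : (0 : ℝ) < m := by exact_mod_cast hm
  have hk : (n : ℝ) * m / ((n : ℝ) + m) = (m : ℝ) * n / ((m : ℝ) + n) := by
    rw [mul_comm, add_comm]
  have hk0 : (m : ℝ) * n / ((m : ℝ) + n) ≠ 0 := by positivity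
  rw [statT_eq hμ hM, deviation_eq hμ hM (hX 0) (hY 0), hk, mul_div_cancel_left₀ _ hk0,
    integral_sq_sub_integral_sq hX hY, neg_mul, ← mul_assoc, ← mul_assoc,
    sqrt_harmonic_mul_inv hn' hm', sqrt_harmonic_mul_inv hm' hn', hk]
  field_simp
  ring

/-- The quadratic remainder is negligible. -/
theorem tendstoInMeasure_remainder {X Y : ℕ → Ω → EuclideanSpace ℝ (Fin d)}
    (hX : ∀ j, Measurable (X j)) (hY : ∀ j, Measurable (Y j)) (hXi : iIndepFun X P)
    (hYi : iIndepFun Y P) (hXd : ∀ j, IdentDistrib (X j) (X 0) P P)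
    (hYd : ∀ j, IdentDistrib (Y j) (Y 0) P P) {n m : ℕ → ℕ} (hn : Tendsto n atTop atTop)
    (hm : Tendsto m atTop atTop) :
    TendstoInMeasure P (fun s ω => √((m s : ℝ) * n s / ((m s : ℝ) + n s)) *
        ∫ t, (empCS X (n s) ω t - empCS Y (m s) ω t - zFun P (X 0) (Y 0) t) ^ 2 ∂μ) atTop 0 := by
  have hmeas : ∀ s, Measurable fun ω => √((m s : ℝ) * n s / ((m s : ℝ) + n s)) *
      ∫ t, (empCS X (n s) ω t - empCS Y (m s) ω t - zFun P (X 0) (Y 0) t) ^ 2 ∂μ := fun s => by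
    have hz : Measurable fun p : Ω × EuclideanSpace ℝ (Fin d) => zFun P (X 0) (Y 0) p.2 :=
      (continuous_zFun (P := P) (hX 0) (hY 0)).measurable.comp measurable_snd
    have hm : Measurable fun p : Ω × EuclideanSpace ℝ (Fin d) =>
        (empCS X (n s) p.1 p.2 - empCS Y (m s) p.1 p.2 - zFun P (X 0) (Y 0) p.2) ^ 2 :=
      (((measurable_empCS hX _).sub (measurable_empCS hY _)).sub hz).pow_const 2
    exact (hm.stronglyMeasurable.integral_prod_right (ν := μ)).measurable.const_mul _
  refine tendstoInMeasure_of_tendsto_eLpNorm one_ne_zero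
    (fun s => (hmeas s).aestronglyMeasurable) aestronglyMeasurable_const ?_
  -- With `r = 1/n + 1/m` the scaling factor is `r^(-1/2)` and the mean remainder is at most `8
  -- μ(univ) r`; their product is this bound.
  have hlim : Tendsto (fun s => 8 * μ.real Set.univ * √((n s : ℝ)⁻¹ + (m s : ℝ)⁻¹)) atTop
      (𝓝 0) := by
    have h1 : Tendsto (fun s => (n s : ℝ)⁻¹ + (m s : ℝ)⁻¹) atTop (𝓝 (0 + 0)) :=
      (tendsto_inv_atTop_zero.comp (tendsto_natCast_atTop_atTop.comp hn)).add
        (tendsto_inv_atTop_zero.comp (tendsto_natCast_atTop_atTop.comp hm))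
    have h2 := (h1.sqrt).const_mul (8 * μ.real Set.univ)
    simpa using h2
  have hlim' := ENNReal.tendsto_ofReal hlim
  rw [ENNReal.ofReal_zero] at hlim'
  refine tendsto_of_tendsto_of_tendsto_of_le_of_le' tendsto_const_nhds hlim'
    (Eventually.of_forall fun _ => zero_le) ?_
  filter_upwards [hn.eventually_gt_atTop 0, hm.eventually_gt_atTop 0] with s hns hms
  have hn' : (0 : ℝ) < n s := by exact_mod_cast hns
  have hm' : (0 : ℝ) < m s := by exact_mod_cast hms
  have hJ := integral_integral_sq_le (μ := μ) hX hY hXi hYi hXd hYd hns hms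
  have hint : Integrable (fun ω => √((m s : ℝ) * n s / ((m s : ℝ) + n s)) *
      ∫ t, (empCS X (n s) ω t - empCS Y (m s) ω t - zFun P (X 0) (Y 0) t) ^ 2 ∂μ) P := by
    refine Integrable.of_bound (hmeas s).aestronglyMeasurable
      (√((m s : ℝ) * n s / ((m s : ℝ) + n s)) * (8 ^ 2 * μ.real Set.univ))
      (ae_of_all _ fun ω => ?_)
    rw [norm_mul, Real.norm_of_nonneg (Real.sqrt_nonneg _)]
    gcongr
    refine norm_integral_le_of_norm_le_const (μ := μ) (f := fun t =>
      (empCS X (n s) ω t - empCS Y (m s) ω t - zFun P (X 0) (Y 0) t) ^ 2) (ae_of_all _ fun t => ?_)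
    rw [Real.norm_eq_abs, abs_pow]
    gcongr
    refine (abs_sub _ _).trans ?_
    linarith [abs_sub (empCS X (n s) ω t) (empCS Y (m s) ω t), abs_empCS_le X (n s) ω t,
      abs_empCS_le Y (m s) ω t, abs_zFun_le (P := P) (X 0) (Y 0) t]
  rw [sub_zero, eLpNorm_one_eq_lintegral_enorm, ← ofReal_integral_norm_eq_lintegral_enorm hint]
  refine ENNReal.ofReal_le_ofReal ?_
  have habs : ∀ ω, ‖√((m s : ℝ) * n s / ((m s : ℝ) + n s)) *
      ∫ t, (empCS X (n s) ω t - empCS Y (m s) ω t - zFun P (X 0) (Y 0) t) ^ 2 ∂μ‖ =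
      √((m s : ℝ) * n s / ((m s : ℝ) + n s)) *
      ∫ t, (empCS X (n s) ω t - empCS Y (m s) ω t - zFun P (X 0) (Y 0) t) ^ 2 ∂μ := fun ω =>
    Real.norm_of_nonneg
      (mul_nonneg (Real.sqrt_nonneg _) (integral_nonneg fun t => sq_nonneg _))
  simp_rw [habs]
  rw [integral_const_mul]
  have hk : (m s : ℝ) * n s / ((m s : ℝ) + n s) = ((n s : ℝ)⁻¹ + (m s : ℝ)⁻¹)⁻¹ := by
    field_simp
  have hpos : 0 < √((n s : ℝ)⁻¹ + (m s : ℝ)⁻¹) := Real.sqrt_pos.2 (by positivity)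
  have hss := Real.mul_self_sqrt (by positivity : (0 : ℝ) ≤ (n s : ℝ)⁻¹ + (m s : ℝ)⁻¹)
  rw [hk, Real.sqrt_inv, inv_mul_le_iff₀ hpos]
  calc _ ≤ _ := hJ
    _ = 8 * μ.real Set.univ *
        (√((n s : ℝ)⁻¹ + (m s : ℝ)⁻¹) * √((n s : ℝ)⁻¹ + (m s : ℝ)⁻¹)) := by rw [hss]
    _ = _ := by ring

end Decomposition

end CFTwoSample

/-! ### The limit theorem. -/

theorem theorem3 {d : ℕ}
    -- a nonempty Borel set, symmetric about the origin
    (M : Set (EuclideanSpace ℝ (Fin d))) (hM : MeasurableSet M) (hM_ne : M.Nonempty)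
    (hM_symm : ∀ x, x ∈ M → -x ∈ M)
    -- a finite measure on it (that is, one carried by it), invariant under reflection
    (μ : Measure (EuclideanSpace ℝ (Fin d))) [IsFiniteMeasure μ] (hμM : μ Mᶜ = 0)
    (hμ_symm : μ.map (fun x => -x) = μ)
    {Ω : Type*} [MeasurableSpace Ω] (P : Measure Ω) [IsProbabilityMeasure P]
    -- two samples of random vectors with values in the set, all independent
    (X Y : ℕ → Ω → EuclideanSpace ℝ (Fin d))
    (hX : ∀ j, Measurable (X j)) (hY : ∀ j, Measurable (Y j))
    (hXM : ∀ j ω, X j ω ∈ M) (hYM : ∀ j ω, Y j ω ∈ M)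
    (hindep : iIndepFun (Sum.elim X Y) P)
    -- with common densities `f` and `g`
    (f g : EuclideanSpace ℝ (Fin d) → ℝ≥0∞) (hf : Measurable f) (hg : Measurable g)
    (hXf : ∀ j, P.map (X j) = μ.withDensity f) (hYg : ∀ j, P.map (Y j) = μ.withDensity g)
    (hΔ : 0 < CFTwoSample.deviation M μ P (X 0) (Y 0))
    -- the limiting regime
    (τ : ℝ) (hτ : τ ∈ Set.Icc (0 : ℝ) 1)
    (n m : ℕ → ℕ) (hn : Tendsto n atTop atTop) (hm : Tendsto m atTop atTop)
    (hnm : Tendsto (fun s => (m s : ℝ) / ((m s : ℝ) + n s)) atTop (𝓝 τ)) :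
    ∃ v : ℝ≥0, (v : ℝ) = CFTwoSample.sigmaSq M μ P (X 0) (Y 0) τ ∧
      TendstoInDistribution
        (fun (s : ℕ) (ω : Ω) =>
          √((m s : ℝ) * n s / ((m s : ℝ) + n s)) *
            (CFTwoSample.statT M μ X Y (n s) (m s) ω / ((m s : ℝ) * n s / ((m s : ℝ) + n s))
              - CFTwoSample.deviation M μ P (X 0) (Y 0)))
        atTop (id : ℝ → ℝ) (fun _ => P) (gaussianReal 0 v) := by
  -- The densities serve to express that each sample has a common law.
  have hXd : ∀ j, IdentDistrib (X j) (X 0) P P := fun j =>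
    ⟨(hX j).aemeasurable, (hX 0).aemeasurable, by rw [hXf j, hXf 0]⟩
  have hYd : ∀ j, IdentDistrib (Y j) (Y 0) P P := fun j =>
    ⟨(hY j).aemeasurable, (hY 0).aemeasurable, by rw [hYg j, hYg 0]⟩
  have hXi : iIndepFun X P := hindep.precomp (g := Sum.inl) Sum.inl_injective
  have hYi : iIndepFun Y P := hindep.precomp (g := Sum.inr) Sum.inr_injective
  have hzm := (CFTwoSample.continuous_zFun (P := P) (hX 0) (hY 0)).measurable
  have hh : Measurable (CFTwoSample.proj μ (CFTwoSample.zFun P (X 0) (Y 0))) :=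
    CFTwoSample.measurable_proj hzm
  have hhb := CFTwoSample.abs_proj_le (μ := μ) (CFTwoSample.abs_zFun_le (P := P) (X 0) (Y 0))
  have hσ := CFTwoSample.sigmaSq_eq (P := P) (hX 0) (hY 0) hμM τ
  have hτ1 : 0 ≤ 1 - τ := sub_nonneg.2 hτ.2
  have hσ0 : 0 ≤ CFTwoSample.sigmaSq M μ P (X 0) (Y 0) τ := by
    rw [hσ]
    exact add_nonneg (mul_nonneg hτ.1 (variance_nonneg _ _))
      (mul_nonneg hτ1 (variance_nonneg _ _))
  obtain ⟨v, hv⟩ : ∃ v : ℝ≥0, (v : ℝ) = CFTwoSample.sigmaSq M μ P (X 0) (Y 0) τ :=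
    ⟨⟨_, hσ0⟩, rfl⟩
  refine ⟨v, hv, ?_⟩
  -- Once `n > 0`, `n/(n+m) = 1 - m/(m+n)`; the sign reflects that the `Y`-average is subtracted.
  have hb : Tendsto (fun s => -√((n s : ℝ) / (n s + m s))) atTop (𝓝 (-√(1 - τ))) := by
    refine (Tendsto.sqrt ((hnm.const_sub 1).congr' ?_)).neg
    filter_upwards [hn.eventually_gt_atTop 0] with s hs
    have : (0 : ℝ) < n s := by exact_mod_cast hs
    field_simp
    ring
  have hL := CFTwoSample.tendstoInDistribution_two_sample
    (U := fun j ω => CFTwoSample.proj μ (CFTwoSample.zFun P (X 0) (Y 0)) (X j ω))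
    (V := fun j ω => CFTwoSample.proj μ (CFTwoSample.zFun P (X 0) (Y 0)) (Y j ω))
    (P := P) (v := v) (α := √τ) (β := -√(1 - τ))
    (a := fun s => √((m s : ℝ) / (m s + n s))) (b := fun s => -√((n s : ℝ) / (n s + m s)))
    (by
      convert! hindep.comp
        (fun _ => CFTwoSample.proj μ (CFTwoSample.zFun P (X 0) (Y 0))) (fun _ => hh) using 1
      ext (j | j) ω <;> rfl)
    (fun j => hh.comp (hX j)) (fun j => hh.comp (hY j))
    (fun j => (hXd j).comp hh) (fun j => (hYd j).comp hh)
    (MemLp.of_bound (hh.comp (hX 0)).aestronglyMeasurable _ (ae_of_all _ fun ω => hhb _))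
    (MemLp.of_bound (hh.comp (hY 0)).aestronglyMeasurable _ (ae_of_all _ fun ω => hhb _))
    hn hm hnm.sqrt hb (by
      rw [neg_sq, Real.sq_sqrt hτ.1, Real.sq_sqrt hτ1]
      exact hv.trans hσ)
  -- Slutsky: the statistic differs from the linear part by a remainder tending to `0` in measure.
  -- The exact identity for it holds once both sample sizes are positive, hence eventually.
  refine tendstoInDistribution_of_tendstoInMeasure_sub _ _ hL ?_ fun s => ?_
  · refine (CFTwoSample.tendstoInMeasure_remainder (μ := μ) hX hY hXi hYi hXd hYd hn hm).congr'
      ?_ EventuallyEq.rfl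
    filter_upwards [hn.eventually_gt_atTop 0, hm.eventually_gt_atTop 0] with s hns hms
    exact ae_of_all _ fun ω =>
      (CFTwoSample.normalized_statT_sub hμ_symm hμM hX hY hns hms ω).symm
  · have := CFTwoSample.measurable_statT hμ_symm hμM hX hY (n s) (m s)
    exact (((this.div_const _).sub_const _).const_mul _).aemeasurable
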